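/- Let $\mathbb K$ be $\mathbb R$ or $\mathbb C$, let $p\in\mathbb N=\{1,2,\dots\}$, let $X$ be an open subset of $\mathbb R^p$, and let $m\in\mathbb N\cup\{\infty\}$ (with the convention $\infty+1=\infty$). Let $E$ and $F$ be locally convex Fréchet spaces over $\mathbb K$, that is, complete metrizable locally convex topological vector spaces. Denote by $C^m(X,E)$ the vector space of all functions $f:X\to E$ having continuous partial derivatives of all orders $<m+1$, and similarly for $F$. For a multi-index $\lambda=(\lambda_1,\dots,\lambda_p)$ of nonnegative integers put $|\lambda|=\lambda_1+\dots+\lambda_p$ and $\partial^\lambda=(\partial^1)^{\lambda_1}\cdots(\partial^p)^{\lambda_p}$. For $u\in E$, let $\mathbf u\in C^m(X,E)$ be the function with constant value $u$. Suppose that the map $\Phi:X\times E\to F$ has the property that $Tf(x)=\Phi(x,f(x))$ defines a linear operator $T$ from $C^m(X,E)$ into $C^m(X,F)$. Then: 1. If $C^m(X,E)$ and $C^m(X,F)$ are endowed with complete linear metric topologies (vector space topologies given by complete translation-invariant metrics) that are stronger than (that is, at least as fine as) the respective topologies of pointwise convergence, then $T$ is continuous. 2. For every multi-index $\lambda$ with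 $|\lambda|<m+1$, the map $\Phi_\lambda:X\times E\to F$ defined by $\Phi_\lambda(x,u)=(\partial^\lambda T\mathbf u)(x)$ is (jointly) continuous. -/

import Mathlib

open Filter Topology TopologicalSpace

noncomputable section

namespace AutoCont

section Derivatives

variable {p : ℕ} {X : Opens (EuclideanSpace ℝ (Fin p))}
variable {E : Type*} [AddCommGroup E] [Module ℝ E] [TopologicalSpace E]

/-- `v` is the partial derivative in the `i`-th coordinate at the point `x` of the function `f`
on the open set `X`: the limit, as the nonzero real number `t` tends to `0`, of
`(f (x + t eᵢ) - f x) / t`.  (As `X` is open, `x + t eᵢ ∈ X` for all small `t`, so the extension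
of `f` by `0` outside `X` plays no role in the limit.) -/
def HasPartialDerivAt (i : Fin p) (f : X → E) (v : E) (x : X) : Prop :=
  Tendsto
    (fun t : ℝ => t⁻¹ •
      (Function.extend (Subtype.val : X → EuclideanSpace ℝ (Fin p)) f 0
        ((x : EuclideanSpace ℝ (Fin p)) + t • EuclideanSpace.single i (1 : ℝ)) - f x))
    (𝓝[≠] 0) (𝓝 v)

/-- All partial derivatives of `f` of order at most `k` exist and are continuous on `X`. -/
def HasContPartials : ℕ → (X → E) → Prop
  | 0, f => Continuous f
  | k + 1, f => Continuous f ∧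
      ∀ i : Fin p, ∃ g : X → E, (∀ x, HasPartialDerivAt i f (g x) x) ∧ HasContPartials k g

open Classical in
/-- The partial derivative `∂ⁱ f`, with value `0` at the points where it does not exist. -/
def partialDeriv (i : Fin p) (f : X → E) : X → E := fun x =>
  if h : ∃ v, HasPartialDerivAt i f v x then h.choose else 0

/-- The partial derivative `∂^l f = (∂¹)^{l₁} ⋯ (∂ᵖ)^{l_p} f` for a multi-index `l`. -/
def multiPartial (l : Fin p → ℕ) (f : X → E) : X → E :=
  (List.finRange p).foldr (fun i g => (partialDeriv i)^[l i] g) f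

theorem hasPartialDerivAt_const (i : Fin p) (u : E) (x : X) :
    HasPartialDerivAt i (fun _ : X => u) 0 x := by
  have hcont : Tendsto (fun t : ℝ => (x : EuclideanSpace ℝ (Fin p)) +
      t • EuclideanSpace.single i (1 : ℝ)) (𝓝[≠] 0) (𝓝 (x : EuclideanSpace ℝ (Fin p))) := by
    have h : Continuous (fun t : ℝ => (x : EuclideanSpace ℝ (Fin p)) +
      t • EuclideanSpace.single i (1 : ℝ)) := by fun_prop
    simpa using (h.tendsto 0).mono_left nhdsWithin_le_nhds
  refine tendsto_const_nhds.congr' ?_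
  filter_upwards [hcont (X.isOpen.mem_nhds x.2)] with t ht
  have := Subtype.val_injective.extend_apply (fun _ : X => u) 0 ⟨_, ht⟩
  simp only at this
  rw [this, sub_self, smul_zero]

theorem HasPartialDerivAt.add [ContinuousAdd E] {i : Fin p} {f g : X → E} {v w : E} {x : X}
    (hf : HasPartialDerivAt i f v x) (hg : HasPartialDerivAt i g w x) :
    HasPartialDerivAt i (f + g) (v + w) x := by
  refine (Tendsto.add hf hg).congr fun t => ?_
  have : Function.extend (Subtype.val : X → EuclideanSpace ℝ (Fin p)) (f + g) 0
      = Function.extend Subtype.val f 0 + Function.extend Subtype.val g 0 := by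
    simpa using Function.extend_add (Subtype.val : X → EuclideanSpace ℝ (Fin p)) f g 0 0
  rw [this, ← smul_add]
  congr 1
  simp only [Pi.add_apply]
  abel

theorem HasPartialDerivAt.smul {𝕜 : Type*} [RCLike 𝕜] [Module 𝕜 E] [IsScalarTower ℝ 𝕜 E]
    [ContinuousConstSMul 𝕜 E] (c : 𝕜) {i : Fin p} {f : X → E} {v : E} {x : X}
    (hf : HasPartialDerivAt i f v x) : HasPartialDerivAt i (c • f) (c • v) x := by
  refine (Tendsto.const_smul hf c).congr fun t => ?_
  have : Function.extend (Subtype.val : X → EuclideanSpace ℝ (Fin p)) (c • f) 0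
      = c • Function.extend Subtype.val f 0 := by
    simpa using Function.extend_smul c (Subtype.val : X → EuclideanSpace ℝ (Fin p)) f 0
  rw [this, smul_comm c t⁻¹, smul_sub]
  rfl

theorem hasContPartials_const (k : ℕ) (u : E) : HasContPartials k (fun _ : X => u) := by
  induction k generalizing u with
  | zero => exact continuous_const
  | succ k ih =>
    exact ⟨continuous_const, fun i => ⟨fun _ => 0, fun x => hasPartialDerivAt_const i u x, ih 0⟩⟩

theorem HasContPartials.add [ContinuousAdd E] {k : ℕ} {f g : X → E}
    (hf : HasContPartials k f) (hg : HasContPartials k g) : HasContPartials k (f + g) := by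
  induction k generalizing f g with
  | zero => exact Continuous.add hf hg
  | succ k ih =>
    refine ⟨Continuous.add hf.1 hg.1, fun i => ?_⟩
    obtain ⟨f', hf', hf''⟩ := hf.2 i
    obtain ⟨g', hg', hg''⟩ := hg.2 i
    exact ⟨f' + g', fun x => (hf' x).add (hg' x), ih hf'' hg''⟩

theorem HasContPartials.smul {𝕜 : Type*} [RCLike 𝕜] [Module 𝕜 E] [IsScalarTower ℝ 𝕜 E]
    [ContinuousConstSMul 𝕜 E] (c : 𝕜) {k : ℕ} {f : X → E}
    (hf : HasContPartials k f) : HasContPartials k (c • f) := by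
  induction k generalizing f with
  | zero => exact Continuous.const_smul hf c
  | succ k ih =>
    refine ⟨Continuous.const_smul hf.1 c, fun i => ?_⟩
    obtain ⟨f', hf', hf''⟩ := hf.2 i
    exact ⟨c • f', fun x => (hf' x).smul c, ih hf''⟩

end Derivatives

section Spaces

variable {p : ℕ} (𝕜 : Type*) [RCLike 𝕜] (m : ℕ∞) (X : Opens (EuclideanSpace ℝ (Fin p)))
variable (E : Type*) [AddCommGroup E] [Module 𝕜 E] [Module ℝ E] [IsScalarTower ℝ 𝕜 E]
  [TopologicalSpace E] [ContinuousAdd E] [ContinuousConstSMul 𝕜 E]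

/-- The vector space `C^m(X, E)` of functions from `X` to `E` having continuous partial
derivatives of all orders `< m + 1` (where `∞ + 1 = ∞`). -/
def CSpace : Submodule 𝕜 (X → E) where
  carrier := {f | ∀ k : ℕ, (k : ℕ∞) < m + 1 → HasContPartials k f}
  add_mem' hf hg k hk := (hf k hk).add (hg k hk)
  zero_mem' k _ := hasContPartials_const k 0
  smul_mem' c _ hf k hk := (hf k hk).smul c

variable {E}

/-- The constant function with value `u`, as an element of `C^m(X, E)`. -/
def constFun (u : E) : CSpace 𝕜 m X E := ⟨fun _ => u, fun k _ => hasContPartials_const k u⟩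

variable (E)

/-- The topology of pointwise convergence on `C^m(X, E)`. -/
abbrev pointwiseTopology : TopologicalSpace (CSpace 𝕜 m X E) :=
  TopologicalSpace.induced (fun f => (f : X → E)) Pi.topologicalSpace

end Spaces

/-- A complete linear metric topology on a vector space: a vector space topology that is given by
a complete translation-invariant metric. -/
structure IsCompleteLinearMetricTopology (𝕜 : Type*) [RCLike 𝕜] {V : Type*} [AddCommGroup V]
    [Module 𝕜 V] (τ : TopologicalSpace V) : Prop where
  continuous_add : @ContinuousAdd V τ _
  continuous_smul : @ContinuousSMul 𝕜 V _ _ τ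
  exists_metric : ∃ d : MetricSpace V,
    d.toUniformSpace.toTopologicalSpace = τ ∧
    (∀ x y z : V, d.dist (x + z) (y + z) = d.dist x y) ∧
    @CompleteSpace V d.toUniformSpace

end AutoCont

end

/-! Evaluating `T` on constants gives linear maps `A x : E → F`, and `T f x = A x (f x)`. Everything
rests on each `A x` being continuous (`continuous_of_forall_continuous_apply`). Suppose `q ∘ A x₀`
is discontinuous for a continuous seminorm `q` on `F`. As `E` is barrelled, discontinuity persists
for all `x` near `x₀`. Fix `y n → x₀` and a smooth `ℓ¹`-valued `g` with `g (y n) = c n • eₙ`. Choose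
`v n → 0` with `q (A (y n) (v n)) > n / c n`, and let `L : ℓ¹ → E` send `eₙ` to `v n`. Then `f = L ∘
g` is smooth but `q (T f (y n)) > n`, contradicting continuity of `T f` at `x₀`. Routing through
`ℓ¹` fixes `g` and `c` before `v`, so no derivative estimates in `E` are needed. Part 1 is then the
closed graph theorem, since convergence in either topology implies pointwise convergence. For part
2, Banach–Steinhaus keeps derivatives in `x` continuous and linear in `u`, and equicontinuity gives
joint continuity. -/

/-! ### Closed graph theorem for F-spaces -/

section ClosedGraph

/-- The closed graph theorem for complete linear metric topologies. -/
theorem AutoCont.IsCompleteLinearMetricTopology.continuous_of_seq_closed_graph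
    {𝕜 : Type*} [RCLike 𝕜] {V W : Type*} [AddCommGroup V] [Module 𝕜 V] [AddCommGroup W]
    [Module 𝕜 W] {τV : TopologicalSpace V} {τW : TopologicalSpace W}
    (hV : AutoCont.IsCompleteLinearMetricTopology 𝕜 τV)
    (hW : AutoCont.IsCompleteLinearMetricTopology 𝕜 τW) (T : V →ₗ[𝕜] W)
    (hT : ∀ (u : ℕ → V) (x : V) (y : W), Tendsto u atTop (@nhds V τV x) →
      Tendsto (fun n => T (u n)) atTop (@nhds W τW y) → T x = y) :
    Continuous T := by
  have := hV.continuous_add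
  have := hV.continuous_smul
  have := hW.continuous_add
  have := hW.continuous_smul
  obtain ⟨dV, rfl, invV, complV⟩ := hV.exists_metric
  obtain ⟨dW, rfl, invW, complW⟩ := hW.exists_metric
  have hsubV : ∀ x y : V, dist (x - y) 0 = dist x y := fun x y => by
    simpa using (invV (x - y) 0 y).symm
  have hsubW : ∀ x y : W, dist (x - y) 0 = dist x y := fun x y => by
    simpa using (invW (x - y) 0 y).symm
  have haddW : ∀ x y : W, dist (x + y) 0 ≤ dist x 0 + dist y 0 := fun x y => by
    have h := dist_triangle (x + y) y 0
    have h' := invW x 0 y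
    rw [zero_add] at h'
    linarith
  -- closures of preimages of balls are neighbourhoods of zero
  have key : ∀ r > 0, ∃ δ > 0, ∀ x : V, dist x 0 < δ →
      x ∈ closure (T ⁻¹' Metric.ball (0 : W) r) := by
    intro r hr
    set A : Set V := T ⁻¹' Metric.ball (0 : W) (r / 2) with hA
    have hc : ∀ n : ℕ, ((n : 𝕜) + 1) ≠ 0 := fun n => Nat.cast_add_one_ne_zero n
    have hcover : (⋃ n : ℕ, closure ((fun x : V => ((n : 𝕜) + 1) • x) '' A)) = Set.univ := by
      refine Set.eq_univ_of_forall fun x => ?_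
      have h0 : Tendsto (fun n : ℕ => ((n : 𝕜) + 1)⁻¹ • T x) atTop (𝓝 ((0 : 𝕜) • T x)) := by
        refine Tendsto.smul_const ?_ _
        simpa using tendsto_one_div_add_atTop_nhds_zero_nat (𝕜 := 𝕜)
      rw [zero_smul] at h0
      obtain ⟨n, hn⟩ := (h0.eventually (Metric.ball_mem_nhds _ (half_pos hr))).exists
      refine Set.mem_iUnion.2 ⟨n, subset_closure ⟨((n : 𝕜) + 1)⁻¹ • x, ?_, ?_⟩⟩
      · simpa [hA] using hn
      · simp [smul_smul, hc n]
    -- Baire category; undoing the dilation then shows that `closure A` itself has an interior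
    -- point.
    obtain ⟨n, z, hz⟩ := nonempty_interior_of_iUnion_of_closed (fun n => isClosed_closure) hcover
    have hz' : closure A ∈ 𝓝 (((n : 𝕜) + 1)⁻¹ • z) := by
      have himg : closure ((fun x : V => ((n : 𝕜) + 1) • x) '' A)
          = (fun x : V => ((n : 𝕜) + 1) • x) '' closure A :=
        ((Homeomorph.smulOfNeZero ((n : 𝕜) + 1) (hc n)).image_closure A).symm
      rw [himg, mem_interior_iff_mem_nhds] at hz
      have hcont : ContinuousAt (fun x : V => ((n : 𝕜) + 1) • x) (((n : 𝕜) + 1)⁻¹ • z) :=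
        (continuous_const_smul _).continuousAt
      have := hcont.preimage_mem_nhds (t := (fun x : V => ((n : 𝕜) + 1) • x) '' closure A)
        (by simpa [smul_smul, hc n] using hz)
      rwa [Set.preimage_image_eq _ (smul_right_injective V (hc n))] at this
    set z' := ((n : 𝕜) + 1)⁻¹ • z
    obtain ⟨δ, hδ, hball⟩ := Metric.mem_nhds_iff.1 hz'
    refine ⟨δ, hδ, fun x hx => ?_⟩
    -- `x` is a difference of two points of `closure A`, and `A - A` maps into the ball of radius
    -- `r`; hence `r / 2` in `A`.
    have h1 : x + z' ∈ closure A := hball (by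
      rw [Metric.mem_ball, ← hsubV]; simpa using hx)
    have h2 : z' ∈ closure A := hball (Metric.mem_ball_self hδ)
    rw [Metric.mem_closure_iff]
    intro ε hε
    obtain ⟨a, ha, hda⟩ := Metric.mem_closure_iff.1 h1 (ε / 2) (half_pos hε)
    obtain ⟨b, hb, hdb⟩ := Metric.mem_closure_iff.1 h2 (ε / 2) (half_pos hε)
    refine ⟨a - b, ?_, ?_⟩
    · have ha' : dist (T a) 0 < r / 2 := ha
      have hb' : dist (T b) 0 < r / 2 := hb
      have : dist (T (a - b)) 0 < r := by
        rw [map_sub, hsubW]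
        linarith [dist_triangle (T a) 0 (T b), dist_comm (T b) 0]
      exact this
    · have e1 : dist x (a - b) = dist (x + z') (a - b + z') := (invV _ _ _).symm
      have e2 : dist a (a - b + z') = dist b z' := by
        rw [← invV b z' (a - b)]
        congr 1 <;> abel
      rw [e1]
      linarith [dist_triangle (x + z') a (a - b + z'), dist_comm b z']
  -- successive approximation removes the closure
  have hmain : ∀ ε > 0, ∃ δ > 0, ∀ x : V, dist x 0 < δ → dist (T x) 0 ≤ ε := by
    intro ε hε
    have hr : ∀ n : ℕ, 0 < ε / 2 / 2 ^ n := fun n => by positivity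
    choose δ hδ hδA using fun n => key (ε / 2 / 2 ^ n) (hr n)
    -- The bound `1 / 2 ^ n` forces the remainders to tend to `0`; the closed graph then identifies
    -- the limit of their images as `0`.
    set η : ℕ → ℝ := fun n => min (δ n) (1 / 2 ^ n) with hη
    have hηpos : ∀ n, 0 < η n := fun n => lt_min (hδ n) (by positivity)
    refine ⟨η 0, hηpos 0, fun x hx => ?_⟩
    have step : ∀ (n : ℕ) (y : {y : V // dist y 0 < η n}), ∃ y' : {y : V // dist y 0 < η (n + 1)},
        dist (T (y.1 - y'.1)) 0 < ε / 2 / 2 ^ n := by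
      intro n y
      have hy := hδA n y.1 (y.2.trans_le (min_le_left _ _))
      obtain ⟨a, ha, hda⟩ := Metric.mem_closure_iff.1 hy (η (n + 1)) (hηpos _)
      refine ⟨⟨y.1 - a, by rwa [hsubV]⟩, ?_⟩
      simpa using ha
    choose nxt hnxt using step
    let y : (n : ℕ) → {y : V // dist y 0 < η n} := fun n => Nat.rec ⟨x, hx⟩ (fun n y => nxt n y) n
    have hy : ∀ n, dist (T (y n).1) (T (y (n + 1)).1) ≤ ε / 2 / 2 ^ n := fun n => by
      rw [← hsubW, ← map_sub]
      exact (hnxt n (y n)).le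
    have hy0 : Tendsto (fun n => (y n).1) atTop (𝓝 0) := by
      rw [tendsto_iff_dist_tendsto_zero]
      refine squeeze_zero (fun n => dist_nonneg)
        (fun n => (y n).2.le.trans (min_le_right _ _)) ?_
      simpa using tendsto_pow_atTop_nhds_zero_of_lt_one (r := (1 / 2 : ℝ)) (by norm_num)
        (by norm_num)
    obtain ⟨w, hw⟩ := cauchySeq_tendsto_of_complete (cauchySeq_of_le_geometric_two hy)
    have hw0 : w = 0 := by
      have := hT (fun n => (y n).1) 0 w hy0 hw
      rw [← this, map_zero]
    have := dist_le_of_le_geometric_two_of_tendsto₀ hy hw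
    rwa [hw0] at this
  rw [Metric.continuous_iff]
  intro x ε hε
  obtain ⟨δ, hδ, h⟩ := hmain (ε / 2) (half_pos hε)
  refine ⟨δ, hδ, fun y hy => ?_⟩
  rw [← hsubW, ← map_sub]
  exact (h _ (by rwa [hsubV])).trans_lt (half_lt_self hε)

end ClosedGraph

/-! ### Smooth interpolation in `ℓ¹` -/

section Interpolation

/-- A smooth function with values in `ℓ¹` that interpolates positive multiples of the unit vectors
along a sequence converging to a given point. -/
theorem exists_contDiff_lp_single {V : Type*} [NormedAddCommGroup V] [NormedSpace ℝ V]
    [FiniteDimensional ℝ V] [Nontrivial V] (x₀ : V) {U : Set V} (hU : U ∈ 𝓝 x₀) :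
    ∃ (y : ℕ → V) (c : ℕ → ℝ) (g : V → lp (fun _ : ℕ => ℝ) 1),
      (∀ n, y n ∈ U) ∧ Tendsto y atTop (𝓝 x₀) ∧ (∀ n, 0 < c n) ∧ ContDiff ℝ (⊤ : ℕ∞) g ∧
      ∀ n, g (y n) = lp.single 1 n (c n) := by
  obtain ⟨δ, hδ, hball⟩ := Metric.mem_nhds_iff.1 hU
  obtain ⟨e, he⟩ := exists_norm_eq V zero_le_one
  set t : ℕ → ℝ := fun n => δ / 2 * (1 / 2) ^ n with ht
  have htpos : ∀ n, 0 < t n := fun n => by positivity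
  have htsucc : ∀ n, t (n + 1) = t n / 2 := fun n => by simp only [ht, pow_succ]; ring
  have htanti : Antitone t := antitone_nat_of_succ_le fun n => by
    rw [htsucc]; linarith [htpos n]
  set y : ℕ → V := fun n => x₀ + t n • e with hy
  have hdist : ∀ n k, dist (y n) (y k) = |t n - t k| := fun n k => by
    simp only [hy]
    rw [dist_add_left, dist_eq_norm, ← sub_smul, norm_smul, he, mul_one, Real.norm_eq_abs]
  have hsep : ∀ n k, n ≠ k → t k / 2 ≤ dist (y n) (y k) := by
    intro n k hnk
    rw [hdist]
    rcases lt_or_gt_of_ne hnk with h | h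
    · have := htanti (Nat.succ_le_of_lt h)
      rw [Nat.succ_eq_add_one, htsucc] at this
      exact le_abs.2 (Or.inl (by linarith [htpos k]))
    · have := htanti (Nat.succ_le_of_lt h)
      rw [Nat.succ_eq_add_one, htsucc] at this
      exact le_abs.2 (Or.inr (by linarith))
  -- By `hsep`, the outer radius `t n / 2` makes this bump vanish at every other `y k`.
  let φ : (n : ℕ) → ContDiffBump (y n) := fun n =>
    ⟨t n / 4, t n / 2, by linarith [htpos n], by linarith [htpos n]⟩
  have hφsmooth : ∀ n, ContDiff ℝ (⊤ : ℕ∞) (φ n : V → ℝ) := fun n => (φ n).contDiff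
  have hbound : ∀ n k : ℕ, ∃ C : ℝ, ∀ x, ‖iteratedFDeriv ℝ k (φ n : V → ℝ) x‖ ≤ C := fun n k =>
    ((φ n).hasCompactSupport.iteratedFDeriv k).exists_bound_of_continuous
      ((hφsmooth n).continuous_iteratedFDeriv (by exact_mod_cast le_top))
  choose C hC using hbound
  have hC0 : ∀ n k, 0 ≤ C n k := fun n k => (norm_nonneg _).trans (hC n k x₀)
  -- Diagonal choice: `M n` controls only orders `k ≤ n`, which for fixed `k` omits finitely many
  -- `n`.
  set M : ℕ → ℝ := fun n => 1 + ∑ k ∈ Finset.range (n + 1), C n k with hM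
  have hMpos : ∀ n, 0 < M n := fun n =>
    add_pos_of_pos_of_nonneg one_pos (Finset.sum_nonneg fun k _ => hC0 n k)
  have hMC : ∀ n k, k ≤ n → C n k ≤ M n := fun n k hk => by
    have := Finset.single_le_sum (f := fun k => C n k) (fun k _ => hC0 n k)
      (Finset.mem_range.2 (Nat.lt_succ_of_le hk))
    simp only [hM]
    linarith
  set c : ℕ → ℝ := fun n => (M n)⁻¹ * (1 / 2) ^ n with hc
  have hcpos : ∀ n, 0 < c n := fun n => mul_pos (inv_pos.2 (hMpos n)) (by positivity)
  let L : ℕ → ℝ →L[ℝ] lp (fun _ : ℕ => ℝ) 1 := fun n =>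
    ContinuousLinearMap.toSpanSingleton ℝ (lp.single 1 n (c n))
  have hL : ∀ n, ‖L n‖ = c n := fun n => by
    simp only [L, ContinuousLinearMap.norm_toSpanSingleton]
    rw [lp.norm_single one_pos, Real.norm_eq_abs, abs_of_pos (hcpos n)]
  refine ⟨y, c, fun x => ∑' n, L n (φ n x), fun n => hball ?_, ?_, hcpos, ?_, fun n => ?_⟩
  · have h1 : t n ≤ t 0 := htanti (Nat.zero_le n)
    have h2 : t 0 = δ / 2 := by simp [ht]
    simp only [hy, Metric.mem_ball, dist_self_add_left, norm_smul, he, mul_one, Real.norm_eq_abs,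
      abs_of_pos (htpos n)]
    linarith
  · have h1 : Tendsto t atTop (𝓝 0) := by
      rw [← mul_zero (δ / 2)]
      exact (tendsto_pow_atTop_nhds_zero_of_lt_one (r := (1 / 2 : ℝ)) (by norm_num)
        (by norm_num)).const_mul (δ / 2)
    simpa using (h1.smul_const e).const_add x₀
  · refine contDiff_tsum_of_eventually (v := fun _ n => (1 / 2 : ℝ) ^ n)
      (fun n => (L n).contDiff.comp (hφsmooth n)) (fun k _ => summable_geometric_two)
      (fun k _ => ?_)
    rw [Nat.cofinite_eq_atTop]
    filter_upwards [eventually_ge_atTop k] with n hn x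
    calc ‖iteratedFDeriv ℝ k (L n ∘ (φ n : V → ℝ)) x‖
        ≤ ‖L n‖ * ‖iteratedFDeriv ℝ k (φ n : V → ℝ) x‖ :=
          (L n).norm_iteratedFDeriv_comp_left ((hφsmooth n).contDiffAt)
            (by exact_mod_cast le_top)
      _ ≤ c n * M n := by
          rw [hL]
          exact mul_le_mul_of_nonneg_left ((hC n k x).trans (hMC n k hn)) (hcpos n).le
      _ = (1 / 2) ^ n := by
          simp only [hc]
          field_simp [(hMpos n).ne']
  · change ∑' k, L k (φ k (y n)) = _
    rw [tsum_eq_single n]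
    · rw [(φ n).one_of_mem_closedBall (Metric.mem_closedBall_self (φ n).rIn_pos.le)]
      simp [L]
    · intro k hk
      rw [(φ k).zero_of_le_dist (hsep n k hk.symm), map_zero]

end Interpolation

/-! ### Maps from `ℓ¹` into complete locally convex spaces -/

section LocallyConvex

variable {E : Type*} [AddCommGroup E] [Module ℝ E] [UniformSpace E] [IsUniformAddGroup E]
  [ContinuousSMul ℝ E] [LocallyConvexSpace ℝ E]

theorem exists_continuous_seminorm_ball_subset {U : Set E} (hU : U ∈ 𝓝 (0 : E)) :
    ∃ (q : Seminorm ℝ E) (r : ℝ), Continuous q ∧ 0 < r ∧ ∀ x, q x < r → x ∈ U := by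
  have hE := PolynormableSpace.withSeminorms ℝ E
  obtain ⟨⟨s, r⟩, hr, hs⟩ := hE.hasBasis_zero_ball.mem_iff.1 hU
  refine ⟨_, r, Seminorm.continuous (hE.hasBasis_zero_ball.mem_of_mem (i := (s, r)) hr), hr,
    fun x hx => hs ?_⟩
  simpa [Seminorm.mem_ball] using hx

/-- A bounded sequence in a complete locally convex space is the image of the unit vectors under a
continuous linear map on `ℓ¹`. -/
theorem exists_clm_lp_single_eq_smul [CompleteSpace E] [T2Space E] (v : ℕ → E)
    (hv : ∀ q : Seminorm ℝ E, Continuous q → ∃ C, ∀ n, q (v n) ≤ C) :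
    ∃ L : lp (fun _ : ℕ => ℝ) 1 →L[ℝ] E, ∀ n a, L (lp.single 1 n a) = a • v n := by
  have hle : ∀ (q : Seminorm ℝ E) (C : ℝ), (∀ n, q (v n) ≤ C) → ∀ (a : ℕ → ℝ) (s : Finset ℕ),
      q (∑ n ∈ s, a n • v n) ≤ C * ∑ n ∈ s, ‖a n‖ := fun q C hC a s => by
    refine (Finset.le_sum_of_subadditive q (map_zero q).le (map_add_le_add q) _ _).trans ?_
    rw [Finset.mul_sum]
    refine Finset.sum_le_sum fun n _ => ?_
    rw [map_smul_eq_mul, mul_comm]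
    exact mul_le_mul_of_nonneg_right (hC n) (norm_nonneg _)
  have hnorm : ∀ a : lp (fun _ : ℕ => ℝ) 1, HasSum (fun n => ‖a n‖) ‖a‖ := fun a => by
    simpa using lp.hasSum_norm (p := 1) (by simp) a
  have hsum : ∀ a : lp (fun _ : ℕ => ℝ) 1, Summable fun n => a n • v n := fun a => by
    rw [summable_iff_vanishing]
    intro U hU
    obtain ⟨q, r, hq, hr, hqU⟩ := exists_continuous_seminorm_ball_subset hU
    obtain ⟨C, hC⟩ := hv q hq
    have hC0 : 0 ≤ C := (apply_nonneg q _).trans (hC 0)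
    have hpos : 0 < r / (C + 1) := by positivity
    obtain ⟨s, hs⟩ := summable_iff_vanishing.1 (hnorm a).summable _ (Metric.ball_mem_nhds 0 hpos)
    refine ⟨s, fun u hu => hqU _ ((hle q C hC _ u).trans_lt ?_)⟩
    have h1 := hs u hu
    rw [mem_ball_zero_iff, Real.norm_eq_abs,
      abs_of_nonneg (Finset.sum_nonneg fun n _ => norm_nonneg _), lt_div_iff₀ (by positivity)] at h1
    have h2 : 0 ≤ ∑ n ∈ u, ‖a n‖ := Finset.sum_nonneg fun n _ => norm_nonneg _
    linarith
  let L : lp (fun _ : ℕ => ℝ) 1 →ₗ[ℝ] E :=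
    { toFun := fun a => ∑' n, a n • v n
      map_add' := fun a b => by
        rw [← (hsum a).tsum_add (hsum b)]
        exact tsum_congr fun n => add_smul _ _ _
      map_smul' := fun r a => by
        rw [RingHom.id_apply, ← (hsum a).tsum_const_smul r]
        exact tsum_congr fun n => mul_smul _ _ _ }
  have hL : Continuous L := by
    rw [(PolynormableSpace.withSeminorms ℝ E).continuous_iff_continuous_comp]
    rintro ⟨q, hq⟩
    obtain ⟨C, hC⟩ := hv q hq
    have hC0 : 0 ≤ C := (apply_nonneg q _).trans (hC 0)
    refine Seminorm.continuous_of_le (q := C.toNNReal • normSeminorm ℝ _) ?_ fun a => ?_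
    · exact continuous_norm.const_smul _
    · have h1 : Tendsto (fun s : Finset ℕ => q (∑ n ∈ s, a n • v n)) atTop (𝓝 (q (L a))) :=
        (hq.tendsto _).comp (hsum a).hasSum
      refine le_of_tendsto h1 (Eventually.of_forall fun s => (hle q C hC a s).trans ?_)
      have : (C.toNNReal • normSeminorm ℝ (lp (fun _ : ℕ => ℝ) 1)) a = C * ‖a‖ := by
        simp [NNReal.smul_def, hC0]
      rw [this]
      exact mul_le_mul_of_nonneg_left
        (sum_le_hasSum s (fun n _ => norm_nonneg _) (hnorm a)) hC0
  refine ⟨⟨L, hL⟩, fun n a => ?_⟩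
  change ∑' k, (lp.single 1 n a : lp (fun _ : ℕ => ℝ) 1) k • v k = a • v n
  rw [tsum_eq_single n fun k hk => by rw [lp.single_apply_ne _ _ _ hk, zero_smul],
    lp.single_apply_self]

end LocallyConvex

/-! ### Limits of linear maps on barrelled spaces -/

section BanachSteinhaus

variable {E : Type*} [AddCommGroup E] [Module ℝ E] [UniformSpace E] [IsUniformAddGroup E]
  [BarrelledSpace ℝ E]
variable {F : Type*} [AddCommGroup F] [Module ℝ F]

/-- A pointwise convergent sequence of continuous linear maps on a barrelled space converges
continuously. -/
theorem tendsto_clm_apply_of_tendsto_pointwise [ContinuousSMul ℝ E] [UniformSpace F]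
    [IsUniformAddGroup F] [ContinuousSMul ℝ F] [LocallyConvexSpace ℝ F] {B : ℕ → E →L[ℝ] F} {b : E → F}
    (hB : ∀ u, Tendsto (fun n => B n u) atTop (𝓝 (b u))) {v : ℕ → E} {u : E}
    (hv : Tendsto v atTop (𝓝 u)) : Tendsto (fun n => B n (v n)) atTop (𝓝 (b u)) := by
  have hequi : UniformEquicontinuous fun n => (B n : E → F) :=
    PolynormableSpace.banach_steinhaus fun x => (hB x).isVonNBounded_range ℝ
  rw [Uniform.tendsto_nhds_right, tendsto_def]
  intro S hS
  obtain ⟨R, hR, hRS⟩ := comp_mem_uniformity_sets hS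
  filter_upwards [hv.eventually (hequi.equicontinuous u R hR),
    (Uniform.tendsto_nhds_right.1 (hB u)) hR] with n h1 h2
  exact hRS ⟨_, h2, h1 n⟩

/-- Continuity with respect to a fixed seminorm passes to pointwise limits of sequences of linear
maps on a barrelled space. -/
theorem continuous_seminorm_comp_of_tendsto [TopologicalSpace F]
    {B : ℕ → E →ₗ[ℝ] F} {b : E →ₗ[ℝ] F} (hB : ∀ u, Tendsto (fun n => B n u) atTop (𝓝 (b u))) {q : Seminorm ℝ F}
    (hq : Continuous q) (hqB : ∀ n, Continuous (q.comp (B n))) : Continuous (q.comp b) := by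
  have hlim : ∀ u, Tendsto (fun n => q (B n u)) atTop (𝓝 (q (b u))) := fun u =>
    (hq.tendsto _).comp (hB u)
  have hbdd : BddAbove (Set.range fun n => q.comp (B n)) :=
    Seminorm.bddAbove_range_iff.2 fun u => (hlim u).bddAbove_range
  -- Barrelledness makes the finite supremum continuous, and it dominates `q ∘ b`.
  have hsup := Seminorm.continuous_iSup _ hqB hbdd
  rw [← Seminorm.coe_iSup_eq hbdd] at hsup
  refine Seminorm.continuous_of_le hsup fun u => ?_
  exact le_of_tendsto (hlim u) (Eventually.of_forall fun n => le_ciSup hbdd n u)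

end BanachSteinhaus

/-! ### Calculus of partial derivatives -/

namespace AutoCont

variable {p : ℕ} {X : Opens (EuclideanSpace ℝ (Fin p))}

section Partials

variable {E : Type*} [AddCommGroup E] [Module ℝ E] [TopologicalSpace E]

theorem eventually_add_smul_single_mem (i : Fin p) (x : X) : ∀ᶠ t : ℝ in 𝓝[≠] 0,
    (x : EuclideanSpace ℝ (Fin p)) + t • EuclideanSpace.single i (1 : ℝ) ∈ X := by
  have h : Continuous (fun t : ℝ => (x : EuclideanSpace ℝ (Fin p)) +
    t • EuclideanSpace.single i (1 : ℝ)) := by fun_prop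
  have h0 := (h.tendsto 0).mono_left (nhdsWithin_le_nhds (s := {0}ᶜ))
  rw [zero_smul, add_zero] at h0
  exact h0 (X.isOpen.mem_nhds x.2)

/-- `L` commutes with limits of difference quotients, so all differentiation takes place in the
normed space `B`. -/
theorem hasContPartials_clm_comp {B : Type*} [NormedAddCommGroup B] [NormedSpace ℝ B]
    (L : B →L[ℝ] E) (k : ℕ) {g : EuclideanSpace ℝ (Fin p) → B} (hg : ContDiff ℝ (⊤ : ℕ∞) g) :
    HasContPartials k (fun x : X => L (g x)) := by
  induction k generalizing g with
  | zero => exact L.continuous.comp (hg.continuous.comp continuous_subtype_val)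
  | succ k ih =>
    refine ⟨L.continuous.comp (hg.continuous.comp continuous_subtype_val), fun i => ?_⟩
    refine ⟨fun x => L (fderiv ℝ g x (EuclideanSpace.single i (1 : ℝ))), fun x => ?_, ?_⟩
    · have hd : HasLineDerivAt ℝ g (fderiv ℝ g x (EuclideanSpace.single i (1 : ℝ))) x
          (EuclideanSpace.single i (1 : ℝ)) :=
        ((hg.differentiable (by simp)) x).hasFDerivAt.hasLineDerivAt _
      refine ((L.continuous.tendsto _).comp hd.tendsto_slope_zero).congr' ?_
      filter_upwards [eventually_add_smul_single_mem i x] with t ht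
      have := Subtype.val_injective.extend_apply (fun x : X => L (g x)) 0 ⟨_, ht⟩
      simp only at this
      rw [this]
      simp
    · exact ih (g := fun x => fderiv ℝ g x (EuclideanSpace.single i (1 : ℝ)))
        ((hg.fderiv_right (m := (⊤ : ℕ∞)) (by simp)).clm_apply contDiff_const)

theorem HasContPartials.continuous {k : ℕ} {f : X → E} (hf : HasContPartials k f) :
    Continuous f := by
  cases k with
  | zero => exact hf
  | succ k => exact hf.1

theorem HasPartialDerivAt.partialDeriv_eq [T2Space E] {i : Fin p} {f : X → E} {v : E} {x : X}
    (h : HasPartialDerivAt i f v x) : partialDeriv i f x = v := by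
  have hex : ∃ v, HasPartialDerivAt i f v x := ⟨v, h⟩
  rw [partialDeriv, dif_pos hex]
  exact tendsto_nhds_unique hex.choose_spec h

theorem HasContPartials.partialDeriv [T2Space E] {k : ℕ} {f : X → E}
    (hf : HasContPartials (k + 1) f) (i : Fin p) :
    (∀ x, HasPartialDerivAt i f (partialDeriv i f x) x) ∧
      HasContPartials k (partialDeriv i f) := by
  obtain ⟨g, hg, hgk⟩ := hf.2 i
  have : AutoCont.partialDeriv i f = g := funext fun x => (hg x).partialDeriv_eq
  rw [this]
  exact ⟨hg, hgk⟩

end Partials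

/-! ### Automatic continuity of the fibre maps and their derivatives -/

section Automatic

variable {E : Type*} [AddCommGroup E] [Module ℝ E] [UniformSpace E] [IsUniformAddGroup E]
  [ContinuousSMul ℝ E]
variable {F : Type*} [AddCommGroup F] [Module ℝ F] [UniformSpace F] [IsUniformAddGroup F]
  [ContinuousSMul ℝ F] [LocallyConvexSpace ℝ F]

/-- A family of linear maps that sends smooth functions to continuous ones consists of continuous
maps. -/
theorem continuous_of_forall_continuous_apply [LocallyConvexSpace ℝ E] [CompleteSpace E]
    [FirstCountableTopology E] [T2Space E] [BarrelledSpace ℝ E] (hp : 1 ≤ p) (A : X → E →ₗ[ℝ] F)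
    (hA : ∀ f : X → E, (∀ k, HasContPartials k f) → Continuous fun x => A x (f x)) (x₀ : X) :
    Continuous (A x₀) := by
  -- Positive dimension provides a direction along which distinct points approach `x₀`.
  have : Nonempty (Fin p) := ⟨⟨0, hp⟩⟩
  rw [(PolynormableSpace.withSeminorms ℝ F).continuous_iff_continuous_comp]
  rintro ⟨q, hq⟩
  change Continuous (q.comp (A x₀))
  by_contra hcont
  have hpt : ∀ u, Continuous fun x => A x u := fun u =>
    hA (fun _ => u) fun k => hasContPartials_const k u
  have hdisc : ∀ᶠ x in 𝓝 x₀, ¬ Continuous (q.comp (A x)) := by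
    by_contra h
    obtain ⟨x, hx, hxc⟩ := exists_seq_forall_of_frequently (not_eventually.1 h)
    refine hcont (continuous_seminorm_comp_of_tendsto (B := fun n => A (x n))
      (fun u => ((hpt u).tendsto x₀).comp hx) hq fun n => ?_)
    exact not_not.1 (hxc n)
  obtain ⟨U, hU, hUX⟩ := (mem_nhds_subtype (X : Set (EuclideanSpace ℝ (Fin p))) x₀ _).1 hdisc
  obtain ⟨y, c, g, hyU, hy, hc, hg, hgy⟩ :=
    exists_contDiff_lp_single (x₀ : EuclideanSpace ℝ (Fin p))
      (inter_mem hU (X.isOpen.mem_nhds x₀.2))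
  let z : ℕ → X := fun n => ⟨y n, (hyU n).2⟩
  have hz : Tendsto z atTop (𝓝 x₀) := tendsto_subtype_rng.2 hy
  have hzd : ∀ n, ¬ Continuous (q.comp (A (z n))) := fun n => hUX (a := z n) (hyU n).1
  obtain ⟨N, hN⟩ := (𝓝 (0 : E)).exists_antitone_basis
  -- A seminorm bounded near `0` is continuous; dividing by `c n` offsets the later factor `c n`.
  have hex : ∀ n, ∃ v ∈ N n, (n : ℝ) / c n < q (A (z n) v) := by
    intro n
    by_contra! h
    exact hzd n (Seminorm.continuous' (r := n / c n)
      (mem_of_superset (hN.1.mem_of_mem (i := n) trivial) fun v hv => by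
        simpa [Seminorm.mem_closedBall] using h v hv))
  choose v hvN hvq using hex
  have hv : Tendsto v atTop (𝓝 0) := hN.tendsto hvN
  obtain ⟨L, hL⟩ := exists_clm_lp_single_eq_smul v fun r hr => by
    obtain ⟨C, hC⟩ := ((hr.tendsto 0).comp hv).bddAbove_range
    exact ⟨C, fun n => hC ⟨n, rfl⟩⟩
  have hf := hA (fun x => L (g x)) fun k => hasContPartials_clm_comp L k hg
  obtain ⟨C, hC⟩ := (((hq.comp hf).tendsto x₀).comp hz).bddAbove_range
  obtain ⟨n, hn⟩ := exists_nat_gt C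
  have h1 : q (A (z n) (L (g (z n)))) ≤ C := hC ⟨n, rfl⟩
  have h2 : g (z n) = lp.single 1 n (c n) := hgy n
  rw [h2, hL, map_smul, map_smul_eq_mul, Real.norm_eq_abs, abs_of_pos (hc n)] at h1
  have h3 := hvq n
  rw [div_lt_iff₀ (hc n)] at h3
  linarith

/-- A family `G` of functions on `X` with continuous partials of order at most `k`, whose value at
each point of `X` depends continuously and linearly on the parameter. -/
def IsCLMFamily (k : ℕ) (G : E → X → F) : Prop :=
  (∀ u, HasContPartials k (G u)) ∧ ∃ B : X → E →L[ℝ] F, ∀ x u, B x u = G u x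

/-- The derivative is a pointwise limit of difference quotients, which are continuous linear in `u`;
Banach–Steinhaus passes this to the limit. -/
theorem IsCLMFamily.partialDeriv [BarrelledSpace ℝ E] [T2Space F] {k : ℕ} {G : E → X → F}
    (hG : IsCLMFamily (k + 1) G) (i : Fin p) :
    IsCLMFamily k fun u => partialDeriv i (G u) := by
  obtain ⟨hGk, B, hB⟩ := hG
  refine ⟨fun u => ((hGk u).partialDeriv i).2, ?_⟩
  let Q : X → ℝ → E →L[ℝ] F := fun x t => t⁻¹ •
    (Function.extend (Subtype.val : X → EuclideanSpace ℝ (Fin p)) B 0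
      ((x : EuclideanSpace ℝ (Fin p)) + t • EuclideanSpace.single i (1 : ℝ)) - B x)
  have hQ : ∀ x, Tendsto (fun t u => Q x t u) (𝓝[≠] 0)
      (𝓝 fun u => AutoCont.partialDeriv i (G u) x) := fun x => by
    rw [tendsto_pi_nhds]
    intro u
    refine (((hGk u).partialDeriv i).1 x).congr' ?_
    filter_upwards [eventually_add_smul_single_mem i x] with t ht
    have h1 := Subtype.val_injective.extend_apply B 0 ⟨_, ht⟩
    have h2 := Subtype.val_injective.extend_apply (G u) 0 ⟨_, ht⟩
    simp only at h1 h2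
    simp only [Q]
    rw [h1, h2]
    simp [hB]
  exact ⟨fun x => continuousLinearMapOfTendsto (Q x) (hQ x), fun x u => rfl⟩

theorem IsCLMFamily.iterate_partialDeriv [BarrelledSpace ℝ E] [T2Space F] {k : ℕ}
    {G : E → X → F} (i : Fin p) (a : ℕ) (hG : IsCLMFamily (k + a) G) :
    IsCLMFamily k fun u => (AutoCont.partialDeriv i)^[a] (G u) := by
  induction a generalizing k with
  | zero => exact hG
  | succ a ih =>
    simp only [Function.iterate_succ_apply']
    exact (ih (k := k + 1) (by rwa [add_right_comm])).partialDeriv i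

theorem IsCLMFamily.multiPartial [BarrelledSpace ℝ E] [T2Space F] {G : E → X → F}
    (l : Fin p → ℕ) (hG : IsCLMFamily (∑ i, l i) G) :
    IsCLMFamily 0 fun u => multiPartial l (G u) := by
  -- `k` is the order of smoothness left over, generalized for the induction.
  have hlist : ∀ (s : List (Fin p)) (k : ℕ), IsCLMFamily (k + (s.map l).sum) G →
      IsCLMFamily k fun u => s.foldr (fun i g => (AutoCont.partialDeriv i)^[l i] g) (G u) := by
    intro s
    induction s with
    | nil => exact fun k h => h
    | cons i s ih =>
      intro k h
      simp only [List.foldr_cons]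
      refine IsCLMFamily.iterate_partialDeriv i (l i) (ih (k + l i) ?_)
      rwa [add_assoc, ← List.sum_cons, ← List.map_cons]
  refine hlist _ 0 ?_
  rwa [zero_add, ← List.ofFn_eq_map, List.sum_ofFn]

theorem IsCLMFamily.continuous_uncurry [BarrelledSpace ℝ E] [FirstCountableTopology E] {k : ℕ}
    {G : E → X → F} (hG : IsCLMFamily k G) : Continuous fun q : X × E => G q.2 q.1 := by
  obtain ⟨hGk, B, hB⟩ := hG
  rw [continuous_iff_seqContinuous]
  intro s q hs
  have h1 := (continuous_fst.tendsto q).comp hs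
  have h2 := (continuous_snd.tendsto q).comp hs
  have := tendsto_clm_apply_of_tendsto_pointwise (B := fun n => B (s n).1) (b := fun u => G u q.1)
    (fun u => by
      simp only [hB]
      exact ((hGk u).continuous.tendsto q.1).comp h1) h2
  simp only [hB] at this
  exact this

end Automatic

end AutoCont

theorem theorem5p5 {𝕜 : Type*} [RCLike 𝕜] (p : ℕ) (hp : 1 ≤ p)
    (X : TopologicalSpace.Opens (EuclideanSpace ℝ (Fin p))) (m : ℕ∞) (hm : 1 ≤ m)
    {E : Type*} [AddCommGroup E] [Module 𝕜 E] [Module ℝ E] [IsScalarTower ℝ 𝕜 E]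
    [UniformSpace E] [IsUniformAddGroup E] [ContinuousSMul 𝕜 E] [LocallyConvexSpace ℝ E]
    [TopologicalSpace.MetrizableSpace E] [CompleteSpace E]
    {F : Type*} [AddCommGroup F] [Module 𝕜 F] [Module ℝ F] [IsScalarTower ℝ 𝕜 F]
    [UniformSpace F] [IsUniformAddGroup F] [ContinuousSMul 𝕜 F] [LocallyConvexSpace ℝ F]
    [TopologicalSpace.MetrizableSpace F] [CompleteSpace F]
    (Φ : X × E → F)
    (T : AutoCont.CSpace 𝕜 m X E →ₗ[𝕜] AutoCont.CSpace 𝕜 m X F)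
    (hT : ∀ (f : AutoCont.CSpace 𝕜 m X E) (x : X), (T f : X → F) x = Φ (x, (f : X → E) x)) :
    (∀ (τE : TopologicalSpace (AutoCont.CSpace 𝕜 m X E))
        (τF : TopologicalSpace (AutoCont.CSpace 𝕜 m X F)),
      AutoCont.IsCompleteLinearMetricTopology 𝕜 τE →
      AutoCont.IsCompleteLinearMetricTopology 𝕜 τF →
      τE ≤ AutoCont.pointwiseTopology 𝕜 m X E →
      τF ≤ AutoCont.pointwiseTopology 𝕜 m X F →
      Continuous[τE, τF] T) ∧
    (∀ l : Fin p → ℕ, ((∑ i, l i : ℕ) : ℕ∞) < m + 1 →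
      Continuous (fun q : X × E =>
        AutoCont.multiPartial l (T (AutoCont.constFun 𝕜 m X q.2) : X → F) q.1)) := by
  have : ContinuousSMul ℝ E := IsScalarTower.continuousSMul 𝕜
  have : ContinuousSMul ℝ F := IsScalarTower.continuousSMul 𝕜
  -- Countable generation and completeness make `E` a Baire space, hence barrelled.
  have : (uniformity E).IsCountablyGenerated := IsUniformAddGroup.uniformity_countably_generated
  have : BarrelledSpace ℝ E := inferInstance
  let constLin : E →ₗ[𝕜] AutoCont.CSpace 𝕜 m X E :=
    { toFun := AutoCont.constFun 𝕜 m X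
      map_add' := fun _ _ => rfl
      map_smul' := fun _ _ => rfl }
  let A : X → E →ₗ[ℝ] F := fun x =>
    ((LinearMap.proj x ∘ₗ (AutoCont.CSpace 𝕜 m X F).subtype ∘ₗ T ∘ₗ constLin :
      E →ₗ[𝕜] F)).restrictScalars ℝ
  have hAdef : ∀ x u, A x u = (T (AutoCont.constFun 𝕜 m X u) : X → F) x := fun _ _ => rfl
  -- `f` and the constant `f x` agree at `x`, and `Φ` sees only that value.
  have hAT : ∀ (f : AutoCont.CSpace 𝕜 m X E) (x : X),
      (T f : X → F) x = A x ((f : X → E) x) := fun f x => by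
    rw [hAdef, hT, hT]
    rfl
  have hTk : ∀ (f : AutoCont.CSpace 𝕜 m X E) (k : ℕ), (k : ℕ∞) < m + 1 →
      AutoCont.HasContPartials k (T f : X → F) := fun f => (T f).2
  have hAcont : ∀ x, Continuous (A x) := by
    refine AutoCont.continuous_of_forall_continuous_apply hp A fun f hf => ?_
    have h := (hTk ⟨f, fun k _ => hf k⟩ 0 (by simp)).continuous
    exact h.congr fun x => hAT _ x
  refine ⟨fun τE τF hE hF hEp hFp => ?_, fun l hl => ?_⟩
  · refine hE.continuous_of_seq_closed_graph hF T fun u f g hu hTu => ?_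
    refine Subtype.ext (funext fun x => ?_)
    have h1 : Tendsto (fun n => (u n : X → E) x) atTop (𝓝 ((f : X → E) x)) := by
      have h := hu.mono_right (nhds_mono hEp)
      rw [nhds_induced, tendsto_comap_iff] at h
      exact tendsto_pi_nhds.1 h x
    have h2 : Tendsto (fun n => (T (u n) : X → F) x) atTop (𝓝 ((g : X → F) x)) := by
      have h := hTu.mono_right (nhds_mono hFp)
      rw [nhds_induced, tendsto_comap_iff] at h
      exact tendsto_pi_nhds.1 h x
    refine tendsto_nhds_unique ?_ h2
    simp only [hAT]
    exact ((hAcont x).tendsto _).comp h1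
  · have hfam : AutoCont.IsCLMFamily (∑ i, l i)
        (fun u => (T (AutoCont.constFun 𝕜 m X u) : X → F)) :=
      ⟨fun u => hTk _ _ hl, fun x => ⟨A x, hAcont x⟩, fun x u => rfl⟩
    exact (hfam.multiPartial l).continuous_uncurry
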